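/- Let $\mathbb F_q$ be a finite field and let $1\le \ell\le m$ be integers. Let $G_{\ell,m}$ be the set of all $\ell$-dimensional linear subspaces of $\mathbb F_q^m$, and let $I(\ell,m)$ be the set of integer tuples $\alpha=(\alpha_1<\dots<\alpha_\ell)$ with $1\le\alpha_1$ and $\alpha_\ell\le m$, ordered by $\alpha\le\beta$ if and only if $\alpha_i\le\beta_i$ for all $i$. For each $W\in G_{\ell,m}$ pick an $\ell\times m$ matrix $M_W$ with row space $W$, and for $I\in I(\ell,m)$ let $\det_I(M_W)$ be its minor on the columns in $I$. For $\alpha\in I(\ell,m)$ let $\Omega_\alpha=\{W\in G_{\ell,m} : \det_I(M_W)=0 \text{ for all } I\not\le\alpha\}$, and for $S\subseteq I(\ell,m)$ let $\Omega_S=\bigcup_{\alpha\in S}\Omega_\alpha$. The Grassmann code $C(\ell,m)\subseteq\mathbb F_q^{G_{\ell,m}}$ is the row space of the matrix $(\det_I(M_W))_{I\in I(\ell,m),\,W\in G_{\ell,m}}$, and the Schubert union code $C_S(\ell,m)\subseteq\mathbb F_q^{\Omega_S}$ is its projection on the coordinates in $\Omega_S$. Write $C_S(\ell,m)^\perp\subseteq\mathbb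 F_q^{\Omega_S}$ for the dual code with respect to the standard bilinear form. If $S\subseteq I(\ell,m)$ is downward closed (that is, $\alpha\le\beta$ and $\beta\in S$ imply $\alpha\in S$), then $C_S(\ell,m)^\perp$ is spanned over $\mathbb F_q$ by its minimum weight codewords, that is, by its nonzero codewords whose number of nonzero coordinates is least among all nonzero codewords. (If $C_S(\ell,m)^\perp=0$, there are no such codewords, and the empty set spans the zero code.) -/

import Mathlib

/-- The Grassmannian of all `ℓ`-dimensional linear subspaces of `F ^ m`. -/
abbrev Grassmannian (F : Type*) [Field F] (ℓ m : ℕ) : Type _ :=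
  {W : Submodule F (Fin m → F) // Module.finrank F W = ℓ}

/-- The strictly increasing `ℓ`-tuples of column indices. The indices are `0, …, m - 1`
instead of `1, …, m`. -/
abbrev IndexTuple (ℓ m : ℕ) : Type := Fin ℓ ↪o Fin m

/-- The Bruhat order: entrywise comparison of increasing tuples. -/
def BruhatLE {ℓ m : ℕ} (α β : IndexTuple ℓ m) : Prop := ∀ i, α i ≤ β i

/-- A set of tuples is downward closed for the Bruhat order. -/
def IsDownwardClosed {ℓ m : ℕ} (S : Set (IndexTuple ℓ m)) : Prop :=
  ∀ α β : IndexTuple ℓ m, BruhatLE α β → β ∈ S → α ∈ S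

/-- `M` picks, for every point `W` of the Grassmannian, an `ℓ × m` matrix whose row space
is `W`. -/
def IsRepresentativeChoice {F : Type*} [Field F] {ℓ m : ℕ}
    (M : Grassmannian F ℓ m → Matrix (Fin ℓ) (Fin m) F) : Prop :=
  ∀ W : Grassmannian F ℓ m, Submodule.span F (Set.range (M W).row) = W.1

/-- The maximal minor of an `ℓ × m` matrix on the columns in `I`. -/
def maximalMinor {F : Type*} [Field F] {ℓ m : ℕ}
    (A : Matrix (Fin ℓ) (Fin m) F) (I : IndexTuple ℓ m) : F :=
  (A.submatrix id I).det

/-- The Schubert variety of `α`: all minors on columns `I` with `I ≰ α` vanish. -/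
def schubertVariety {F : Type*} [Field F] {ℓ m : ℕ}
    (M : Grassmannian F ℓ m → Matrix (Fin ℓ) (Fin m) F) (α : IndexTuple ℓ m) :
    Set (Grassmannian F ℓ m) :=
  {W | ∀ I : IndexTuple ℓ m, ¬ BruhatLE I α → maximalMinor (M W) I = 0}

/-- The Schubert union of a set `S` of tuples. -/
def schubertUnion {F : Type*} [Field F] {ℓ m : ℕ}
    (M : Grassmannian F ℓ m → Matrix (Fin ℓ) (Fin m) F) (S : Set (IndexTuple ℓ m)) :
    Set (Grassmannian F ℓ m) :=
  ⋃ α ∈ S, schubertVariety M α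

/-- The Grassmann code: the row space of the matrix of all maximal minors, with rows indexed
by increasing tuples and columns by the points of the Grassmannian. -/
def grassmannCode {F : Type*} [Field F] {ℓ m : ℕ}
    (M : Grassmannian F ℓ m → Matrix (Fin ℓ) (Fin m) F) :
    Submodule F (Grassmannian F ℓ m → F) :=
  Submodule.span F
    (Set.range fun (I : IndexTuple ℓ m) (W : Grassmannian F ℓ m) => maximalMinor (M W) I)

/-- The projection of a code in `F ^ A` on a set `B` of coordinates. -/
def projectedCode {F : Type*} [Field F] {A : Type*} (C : Submodule F (A → F)) (B : Set A) :
    Submodule F (B → F) :=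
  C.map (LinearMap.funLeft F F (Subtype.val : B → A))

/-- The Schubert union code: the projection of the Grassmann code on the Schubert union. -/
def schubertUnionCode {F : Type*} [Field F] {ℓ m : ℕ}
    (M : Grassmannian F ℓ m → Matrix (Fin ℓ) (Fin m) F) (S : Set (IndexTuple ℓ m)) :
    Submodule F (schubertUnion M S → F) :=
  projectedCode (grassmannCode M) (schubertUnion M S)

/-- The set of coordinates of a Schubert union code over a finite field is finite. -/
noncomputable instance schubertUnionFintype {F : Type*} [Field F] [Finite F] {ℓ m : ℕ}
    (M : Grassmannian F ℓ m → Matrix (Fin ℓ) (Fin m) F) (S : Set (IndexTuple ℓ m)) :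
    Fintype (schubertUnion M S) :=
  Fintype.ofFinite _

/-- The dual code for the standard bilinear form. -/
def dualCode {F : Type*} [Field F] {A : Type*} [Fintype A] (C : Submodule F (A → F)) :
    Submodule F (A → F) where
  carrier := {x | ∀ c ∈ C, c ⬝ᵥ x = 0}
  zero_mem' := fun c _ => dotProduct_zero c
  add_mem' := by
    intro x y hx hy c hc
    rw [dotProduct_add, hx c hc, hy c hc, add_zero]
  smul_mem' := by
    intro a x hx c hc
    rw [dotProduct_smul, hx c hc, smul_zero]

/-- The minimum weight codewords: nonzero codewords whose Hamming weight is least among all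
nonzero codewords. -/
def minimumWeightCodewords {F : Type*} [Field F] [DecidableEq F] {A : Type*} [Fintype A]
    (C : Submodule F (A → F)) : Set (A → F) :=
  {x | x ∈ C ∧ x ≠ 0 ∧ ∀ y ∈ C, y ≠ 0 → hammingNorm x ≤ hammingNorm y}

/-! A word on the Schubert union is dual exactly when it is a linear relation among Plücker vectors.
These vectors are nonzero and pairwise non-proportional
(`IsRepresentativeChoice.eq_of_maximalMinor_eq_smul`), so nonzero relations have weight at least 3.
It remains to generate all relations by those of weight at most 3.

Row reduction gives each point a basis `v` with `v i` supported on columns up to `α i`, for some `α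
∈ S`. Expand `v` multilinearly in standard basis vectors, one slot at a time. Intermediate tuples
keep these support bounds, so each Plücker vector is zero or a multiple of one from the union.
Splitting a sum is therefore a relation of weight at most 3, and scaling one of weight at most 2.
The expansion ends at coordinate subspaces with index `J ≤ α`, which lie in `S` by downward closure.
Their Plücker vectors are distinct unit vectors, so a relation reduced to them has zero
coefficients. -/

/-! ### Minors and Cramer's rule -/

/-- A tuple of columns with a nonzero minor has no repetition. -/
theorem injective_of_det_submatrix_ne_zero {F : Type*} [Field F] {ℓ m : ℕ}
    {A : Matrix (Fin ℓ) (Fin m) F} {f : Fin ℓ → Fin m} (h : (A.submatrix id f).det ≠ 0) :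
    Function.Injective f := by
  intro i j hij
  by_contra hne
  exact h (Matrix.det_zero_of_column_eq hne fun k => by simp [hij])

/-- An injective tuple is a permutation of an increasing one. -/
theorem exists_indexTuple_comp_perm {ℓ m : ℕ} {f : Fin ℓ → Fin m} (hf : Function.Injective f) :
    ∃ (I : IndexTuple ℓ m) (σ : Equiv.Perm (Fin ℓ)), f = I ∘ σ := by
  have hs : StrictMono (f ∘ Tuple.sort f) :=
    (Tuple.monotone_sort f).strictMono_of_injective (hf.comp (Tuple.sort f).injective)
  refine ⟨OrderEmbedding.ofStrictMono _ hs, (Tuple.sort f)⁻¹, ?_⟩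
  ext i
  simp

theorem det_submatrix_comp_perm {F : Type*} [Field F] {ℓ m : ℕ}
    (A : Matrix (Fin ℓ) (Fin m) F) (f : Fin ℓ → Fin m) (σ : Equiv.Perm (Fin ℓ)) :
    (A.submatrix id (f ∘ σ)).det = (Equiv.Perm.sign σ : F) * (A.submatrix id f).det := by
  rw [← Matrix.det_permute' σ]
  rfl

/-- Proportionality of the maximal minors extends to all tuples of columns. -/
theorem det_submatrix_eq_mul {F : Type*} [Field F] {ℓ m : ℕ}
    {A B : Matrix (Fin ℓ) (Fin m) F} {c : F}
    (h : ∀ I, maximalMinor A I = c * maximalMinor B I) (f : Fin ℓ → Fin m) :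
    (A.submatrix id f).det = c * (B.submatrix id f).det := by
  by_cases hf : Function.Injective f
  · obtain ⟨I, σ, rfl⟩ := exists_indexTuple_comp_perm hf
    have := h I
    simp only [maximalMinor] at this
    rw [det_submatrix_comp_perm, det_submatrix_comp_perm, this]
    ring
  · have hz : ∀ C : Matrix (Fin ℓ) (Fin m) F, (C.submatrix id f).det = 0 := fun C => by
      by_contra hC
      exact hf (injective_of_det_submatrix_ne_zero hC)
    rw [hz, hz, mul_zero]

/-- Cramer's rule for the normal form of a matrix with respect to a tuple of columns. -/
theorem inv_submatrix_mul_apply {F : Type*} [Field F] {ℓ m : ℕ}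
    (A : Matrix (Fin ℓ) (Fin m) F) (f : Fin ℓ → Fin m) (i : Fin ℓ) (j : Fin m) :
    ((A.submatrix id f)⁻¹ * A) i j =
      (A.submatrix id f).det⁻¹ * (A.submatrix id (Function.update f i j)).det := by
  have h : (A.submatrix id (Function.update f i j)) =
      (A.submatrix id f).updateCol i (fun k => A k j) := by
    ext k l
    by_cases hl : l = i
    · subst hl; simp
    · simp [hl]
  rw [h, ← Matrix.cramer_apply, Matrix.cramer_eq_adjugate_mulVec, Matrix.inv_def,
    Ring.inverse_eq_inv', Matrix.smul_mul]
  simp [Matrix.mul_apply, Matrix.mulVec, dotProduct]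

/-- A matrix with linearly independent rows has a nonzero maximal minor. -/
theorem exists_det_submatrix_ne_zero {F : Type*} [Field F] {ℓ m : ℕ}
    {A : Matrix (Fin ℓ) (Fin m) F} (hA : LinearIndependent F A.row) :
    ∃ f : Fin ℓ → Fin m, (A.submatrix id f).det ≠ 0 := by
  have hsurj : Function.Surjective A.mulVec := by
    have hr := hA.rank_matrix
    have : LinearMap.range A.mulVecLin = ⊤ := by
      apply Submodule.eq_top_of_finrank_eq
      simpa [Matrix.rank] using hr
    exact LinearMap.range_eq_top.mp this
  obtain ⟨B, hB⟩ := Matrix.mulVec_surjective_iff_exists_right_inverse.mp hsurj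
  -- Expanding `det (A * B)` over all column tuples of `A` makes every term a multiple of a minor,
  -- while `A * B = 1`.
  by_contra! h
  have hdet : (A * B).transpose.det = 0 := by
    have : (A * B).transpose = fun k => ∑ j, B j k • A.col j := by
      ext k i
      simp [Matrix.mul_apply, Matrix.col, mul_comm]
    rw [this]
    change Matrix.detRowAlternating.toMultilinearMap _ = _
    rw [MultilinearMap.map_sum]
    refine Finset.sum_eq_zero fun r _ => ?_
    rw [MultilinearMap.map_smul_univ]
    have h' := h r
    rw [← Matrix.det_transpose] at h'
    change _ • (A.submatrix id r).transpose.det = 0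
    rw [h', smul_zero]
  rw [hB] at hdet
  simp at hdet

/-- The determinant vanishes if the rows up to `k` vanish on the columns from `k` on. -/
theorem det_eq_zero_of_block {F : Type*} [Field F] {ℓ : ℕ} (A : Matrix (Fin ℓ) (Fin ℓ) F)
    (k : Fin ℓ) (h : ∀ i j, i ≤ k → k ≤ j → A i j = 0) : A.det = 0 := by
  rw [← Matrix.det_transpose, Matrix.det_apply]
  refine Finset.sum_eq_zero fun σ _ => ?_
  -- Pigeonhole: the rows up to `k` outnumber the columns before `k`.
  obtain ⟨i, hi, hk⟩ : ∃ i, i ≤ k ∧ k ≤ σ i := by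
    by_contra! hc
    have := Finset.card_le_card_of_injOn (s := Finset.Iic k) (t := Finset.Iio k) σ
      (fun i hi => by simpa using hc i (by simpa using hi)) σ.injective.injOn
    simp at this
  rw [Finset.prod_eq_zero (Finset.mem_univ i) (by simpa using h _ _ hi hk), smul_zero]

/-- If the rows of `A` are supported on the columns up to `α i`, only minors with `I ≤ α`
can be nonzero. -/
theorem maximalMinor_eq_zero_of_not_bruhatLE {F : Type*} [Field F] {ℓ m : ℕ}
    {A : Matrix (Fin ℓ) (Fin m) F} {α I : IndexTuple ℓ m} (hA : ∀ i j, α i < j → A i j = 0)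
    (hI : ¬ BruhatLE I α) : maximalMinor A I = 0 := by
  simp only [BruhatLE, not_forall, not_le] at hI
  obtain ⟨k, hk⟩ := hI
  exact det_eq_zero_of_block _ k fun i j hi hj =>
    hA i (I j) ((α.monotone hi).trans_lt (hk.trans_le (I.monotone hj)))

/-! ### Multilinearity in the rows -/

/-- Expansion in all slots: a predicate on tuples that is stable under linear combinations in
each slot extends from tuples of generators to tuples in their spans. -/
theorem forall_mem_span_of_slotwise {F V : Type*} [Field F] [AddCommGroup V] [Module F V]
    {ι : Type*} [Finite ι] [DecidableEq ι] (B : ι → Set V) (Q : (ι → V) → Prop)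
    (h0 : ∀ v i, Q (Function.update v i 0))
    (hadd : ∀ v i a b, (∀ j, v j ∈ Submodule.span F (B j)) → a ∈ Submodule.span F (B i) →
      b ∈ Submodule.span F (B i) → Q (Function.update v i a) → Q (Function.update v i b) →
      Q (Function.update v i (a + b)))
    (hsmul : ∀ v i (c : F) a, (∀ j, v j ∈ Submodule.span F (B j)) →
      a ∈ Submodule.span F (B i) → Q (Function.update v i a) → Q (Function.update v i (c • a)))
    (hB : ∀ v, (∀ i, v i ∈ B i) → Q v) (v : ι → V) (hv : ∀ i, v i ∈ Submodule.span F (B i)) :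
    Q v := by
  have := Fintype.ofFinite ι
  -- `s` holds the slots not yet known to contain a generator.
  suffices H : ∀ (s : Finset ι) (v : ι → V), (∀ i, v i ∈ Submodule.span F (B i)) →
      (∀ i ∉ s, v i ∈ B i) → Q v from H Finset.univ v hv (by simp)
  intro s
  induction s using Finset.induction_on with
  | empty => exact fun v _ h => hB v fun i => h i (by simp)
  | insert i s his ih =>
    intro v hv hs
    suffices H : ∀ a ∈ Submodule.span F (B i), Q (Function.update v i a) by
      simpa using H (v i) (hv i)
    intro a ha
    induction ha using Submodule.span_induction with
    | mem a ha =>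
      refine ih _ (fun j => ?_) fun j hj => ?_
      · by_cases hji : j = i
        · subst hji; simpa using Submodule.subset_span ha
        · simpa [hji] using hv j
      · by_cases hji : j = i
        · subst hji; simpa using ha
        · simpa [hji] using hs j (by simp [hji, hj])
    | zero => exact h0 v i
    | add a b ha hb hQa hQb => exact hadd v i a b hv ha hb hQa hQb
    | smul c a ha hQa => exact hsmul v i c a hv ha hQa

theorem submatrix_update {F : Type*} {ℓ m : ℕ} (v : Fin ℓ → Fin m → F) (i : Fin ℓ)
    (w : Fin m → F) (I : IndexTuple ℓ m) :
    Matrix.submatrix (Function.update v i w) id I =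
      (Matrix.submatrix v id I).updateRow i (w ∘ I) := by
  ext k l
  change Function.update v i w k (I l) = _
  by_cases hk : k = i
  · subst hk; simp
  · rw [Function.update_of_ne hk, Matrix.updateRow_ne hk]
    rfl

theorem maximalMinor_update_add {F : Type*} [Field F] {ℓ m : ℕ} (v : Fin ℓ → Fin m → F)
    (i : Fin ℓ) (a b : Fin m → F) :
    maximalMinor (Function.update v i (a + b)) =
      maximalMinor (Function.update v i a) + maximalMinor (Function.update v i b) := by
  ext I
  simp only [maximalMinor, Pi.add_apply, submatrix_update]
  exact Matrix.det_updateRow_add _ _ _ _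

theorem maximalMinor_update_smul {F : Type*} [Field F] {ℓ m : ℕ} (v : Fin ℓ → Fin m → F)
    (i : Fin ℓ) (c : F) (a : Fin m → F) :
    maximalMinor (Function.update v i (c • a)) = c • maximalMinor (Function.update v i a) := by
  ext I
  simp only [maximalMinor, Pi.smul_apply, submatrix_update]
  exact Matrix.det_updateRow_smul _ _ _ _

theorem maximalMinor_mul {F : Type*} [Field F] {ℓ m : ℕ} (P : Matrix (Fin ℓ) (Fin ℓ) F)
    (A : Matrix (Fin ℓ) (Fin m) F) : maximalMinor (P * A) = P.det • maximalMinor A := by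
  ext I
  simp only [maximalMinor, Pi.smul_apply, smul_eq_mul, ← Matrix.det_mul]
  rfl

/-- Rows in the row space of `A` are obtained by multiplying `A` on the left. -/
theorem exists_mul_eq_of_row_mem_span {F : Type*} [Field F] {ℓ m : ℕ}
    {A B : Matrix (Fin ℓ) (Fin m) F} (h : ∀ i, B i ∈ Submodule.span F (Set.range A.row)) :
    ∃ P : Matrix (Fin ℓ) (Fin ℓ) F, B = P * A := by
  choose P hP using fun i => (Submodule.mem_span_range_iff_exists_fun F).mp (h i)
  refine ⟨P, ?_⟩
  ext i j
  rw [← hP i]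
  simp only [Finset.sum_apply]
  rfl

theorem span_row_mul_le {F : Type*} [Field F] {ℓ m : ℕ} (P : Matrix (Fin ℓ) (Fin ℓ) F)
    (A : Matrix (Fin ℓ) (Fin m) F) :
    Submodule.span F (Set.range (P * A).row) ≤ Submodule.span F (Set.range A.row) := by
  rw [Submodule.span_le]
  rintro _ ⟨i, rfl⟩
  exact (Submodule.mem_span_range_iff_exists_fun F).mpr
    ⟨P i, by ext j; simp only [Finset.sum_apply]; rfl⟩

/-! ### Plücker vectors of points -/

theorem IsRepresentativeChoice.linearIndependent_row {F : Type*} [Field F] {ℓ m : ℕ}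
    {M : Grassmannian F ℓ m → Matrix (Fin ℓ) (Fin m) F} (hM : IsRepresentativeChoice M)
    (W : Grassmannian F ℓ m) : LinearIndependent F (M W).row := by
  rw [linearIndependent_iff_card_eq_finrank_span, Set.finrank, hM W, W.2, Fintype.card_fin]

theorem IsRepresentativeChoice.maximalMinor_ne_zero {F : Type*} [Field F] {ℓ m : ℕ}
    {M : Grassmannian F ℓ m → Matrix (Fin ℓ) (Fin m) F} (hM : IsRepresentativeChoice M)
    (W : Grassmannian F ℓ m) : maximalMinor (M W) ≠ 0 := by
  intro h
  obtain ⟨f, hf⟩ := exists_det_submatrix_ne_zero (hM.linearIndependent_row W)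
  refine hf ?_
  rw [det_submatrix_eq_mul (B := M W) (c := 0) (fun I => by rw [h]; simp) f, zero_mul]

/-- The Plücker coordinates determine the subspace. -/
theorem IsRepresentativeChoice.eq_of_maximalMinor_eq_smul {F : Type*} [Field F] {ℓ m : ℕ}
    {M : Grassmannian F ℓ m → Matrix (Fin ℓ) (Fin m) F} (hM : IsRepresentativeChoice M)
    {W W' : Grassmannian F ℓ m} {c : F} (h : maximalMinor (M W) = c • maximalMinor (M W')) :
    W = W' := by
  obtain ⟨f, hf⟩ := exists_det_submatrix_ne_zero (hM.linearIndependent_row W)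
  have hdet := det_submatrix_eq_mul (A := M W) (B := M W') (fun I => congrFun h I)
  have hf' := hf
  rw [hdet] at hf'
  obtain ⟨hc, hf'⟩ := mul_ne_zero_iff.mp hf'
  -- Entries of the normal form are ratios of minors, so the factor `c` cancels.
  have heq : ((M W).submatrix id f)⁻¹ * M W = ((M W').submatrix id f)⁻¹ * M W' := by
    ext i j
    rw [inv_submatrix_mul_apply, inv_submatrix_mul_apply, hdet, hdet, mul_inv]
    field_simp
  have key : M W = ((M W).submatrix id f * ((M W').submatrix id f)⁻¹) * M W' := by
    rw [Matrix.mul_assoc, ← heq, ← Matrix.mul_assoc,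
      Matrix.mul_nonsing_inv _ (isUnit_iff_ne_zero.mpr hf), Matrix.one_mul]
  apply Subtype.ext
  refine Submodule.eq_of_le_of_finrank_eq ?_ (W.2.trans W'.2.symm)
  rw [← hM W, ← hM W']
  conv_lhs => rw [key]
  exact span_row_mul_le _ _

/-! ### Dual words as relations, and their minimum weight -/

/-- The linear map whose kernel is the dual of the Schubert union code. -/
noncomputable def pluckerCombination {F : Type*} [Field F] [Finite F] {ℓ m : ℕ}
    (M : Grassmannian F ℓ m → Matrix (Fin ℓ) (Fin m) F) (S : Set (IndexTuple ℓ m)) :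
    (schubertUnion M S → F) →ₗ[F] (IndexTuple ℓ m → F) :=
  Fintype.linearCombination F fun W : schubertUnion M S => maximalMinor (M W.1)

theorem mem_dualCode_schubertUnionCode {F : Type*} [Field F] [Finite F] {ℓ m : ℕ}
    {M : Grassmannian F ℓ m → Matrix (Fin ℓ) (Fin m) F} {S : Set (IndexTuple ℓ m)}
    {x : schubertUnion M S → F} :
    x ∈ dualCode (schubertUnionCode M S) ↔ pluckerCombination M S x = 0 := by
  have hI : ∀ I : IndexTuple ℓ m, pluckerCombination M S x I =
      (LinearMap.funLeft F F (Subtype.val : schubertUnion M S → Grassmannian F ℓ m)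
        fun W => maximalMinor (M W) I) ⬝ᵥ x := fun I => by
    simp [pluckerCombination, Fintype.linearCombination_apply, dotProduct,
      LinearMap.funLeft_apply, mul_comm]
  constructor
  · intro hx
    ext I
    rw [hI]
    exact hx _ ⟨_, Submodule.subset_span ⟨I, rfl⟩, rfl⟩
  · rintro hx _ ⟨c, hc, rfl⟩
    induction hc using Submodule.span_induction with
    | mem c hc =>
      obtain ⟨I, rfl⟩ := hc
      rw [← hI, hx]
      rfl
    | zero => simp
    | add a b _ _ ha hb => rw [map_add, add_dotProduct, ha, hb, add_zero]
    | smul c a _ ha => rw [map_smul, smul_dotProduct, ha, smul_zero]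

theorem hammingNorm_single_le {ι F : Type*} [Fintype ι] [DecidableEq ι] [Zero F]
    [DecidableEq F] (i : ι) (c : F) : hammingNorm (Pi.single i c : ι → F) ≤ 1 := by
  refine (Finset.card_le_card (t := {i}) fun j hj => ?_).trans_eq (Finset.card_singleton i)
  by_contra hji
  simp only [Finset.mem_singleton] at hji
  simp [hji] at hj

theorem hammingNorm_sub_le {ι F : Type*} [Fintype ι] [AddGroup F] [DecidableEq F]
    (x y : ι → F) : hammingNorm (x - y) ≤ hammingNorm x + hammingNorm y := by
  have h := hammingDist_triangle x 0 y
  simpa [hammingDist_eq_hammingNorm, add_comm, hammingNorm, hammingDist, eq_comm, sub_eq_zero]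
    using h

/-- Nonzero dual codewords have weight at least three. -/
theorem three_le_hammingNorm {F : Type*} [Field F] [Finite F] [DecidableEq F] {ℓ m : ℕ}
    {M : Grassmannian F ℓ m → Matrix (Fin ℓ) (Fin m) F} (hM : IsRepresentativeChoice M)
    {S : Set (IndexTuple ℓ m)} {x : schubertUnion M S → F}
    (hx : pluckerCombination M S x = 0) (h0 : x ≠ 0) : 3 ≤ hammingNorm x := by
  by_contra! hlt
  obtain ⟨W, hW⟩ := Function.ne_iff.mp h0
  rw [Pi.zero_apply] at hW
  -- `W' = W` is allowed, which covers weight one; there `c = 0` below.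
  obtain ⟨W', hsupp⟩ : ∃ W', ∀ V, V ≠ W → V ≠ W' → x V = 0 := by
    by_contra! h
    obtain ⟨W₁, h₁, -, hx₁⟩ := h W
    obtain ⟨W₂, h₂, h₂₁, hx₂⟩ := h W₁
    have hc : ({W, W₁, W₂} : Finset (schubertUnion M S)).card = 3 := by
      rw [Finset.card_eq_three]
      exact ⟨W, W₁, W₂, h₁.symm, h₂.symm, h₂₁.symm, rfl⟩
    have : ({W, W₁, W₂} : Finset (schubertUnion M S)).card ≤ hammingNorm x :=
      Finset.card_le_card fun V hV => by
        simp only [Finset.mem_insert, Finset.mem_singleton] at hV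
        rcases hV with rfl | rfl | rfl <;> simpa
    omega
  have key : ∃ c : F, maximalMinor (M W.1) = c • maximalMinor (M W'.1) ∧ (W = W' → c = 0) := by
    rw [pluckerCombination, Fintype.linearCombination_apply] at hx
    by_cases hWW : W = W'
    · subst hWW
      rw [Finset.sum_eq_single W (fun V _ hV => by rw [hsupp V hV hV, zero_smul])
        (by simp)] at hx
      exact ⟨0, by simpa [hW] using hx, fun _ => rfl⟩
    · rw [Finset.sum_eq_add W W' hWW (fun V _ hV => by rw [hsupp V hV.1 hV.2, zero_smul])
        (by simp) (by simp)] at hx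
      refine ⟨-(x W)⁻¹ * x W', ?_, fun h => (hWW h).elim⟩
      rw [mul_smul, neg_smul, ← smul_neg, ← eq_neg_of_add_eq_zero_left hx, inv_smul_smul₀ hW]
  obtain ⟨c, hc, hc0⟩ := key
  have hc' := hc0 (Subtype.ext (hM.eq_of_maximalMinor_eq_smul hc))
  rw [hc', zero_smul] at hc
  exact hM.maximalMinor_ne_zero _ hc

/-! ### Subordinate tuples -/

theorem linearIndependent_of_maximalMinor_ne_zero {F : Type*} [Field F] {ℓ m : ℕ}
    {v : Fin ℓ → Fin m → F} (h : maximalMinor v ≠ 0) : LinearIndependent F v := by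
  obtain ⟨I, hI⟩ := Function.ne_iff.mp h
  exact LinearIndependent.of_comp (LinearMap.funLeft F F I)
    (Matrix.linearIndependent_rows_of_det_ne_zero hI)

/-- The Plücker vector of a tuple of vectors subordinate to `α ∈ S` is proportional to that of
a point of the Schubert union. -/
theorem exists_hammingNorm_le_one {F : Type*} [Field F] [Finite F] [DecidableEq F] {ℓ m : ℕ}
    {M : Grassmannian F ℓ m → Matrix (Fin ℓ) (Fin m) F} (hM : IsRepresentativeChoice M)
    {S : Set (IndexTuple ℓ m)} {α : IndexTuple ℓ m} (hα : α ∈ S) {v : Fin ℓ → Fin m → F}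
    (hv : ∀ i j, α i < j → v i j = 0) :
    ∃ x : schubertUnion M S → F,
      hammingNorm x ≤ 1 ∧ pluckerCombination M S x = maximalMinor v := by
  classical
  by_cases h0 : maximalMinor v = 0
  · exact ⟨0, by simp, by rw [map_zero, h0]⟩
  let W : Grassmannian F ℓ m := ⟨Submodule.span F (Set.range v), by
    rw [finrank_span_eq_card (linearIndependent_of_maximalMinor_ne_zero h0), Fintype.card_fin]⟩
  have hspan : Submodule.span F (Set.range (M W).row) = Submodule.span F (Set.range v) := hM W
  obtain ⟨Q, hQ⟩ := exists_mul_eq_of_row_mem_span (A := v) (B := M W) fun i => by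
    change _ ∈ Submodule.span F (Set.range v)
    rw [← hspan]
    exact Submodule.subset_span ⟨i, rfl⟩
  obtain ⟨P, hP⟩ := exists_mul_eq_of_row_mem_span (A := M W) (B := v) fun i => by
    rw [hspan]
    exact Submodule.subset_span ⟨i, rfl⟩
  have hW : W ∈ schubertUnion M S := by
    refine Set.mem_biUnion hα fun I hI => ?_
    refine (congrFun ((congrArg maximalMinor hQ).trans (maximalMinor_mul Q v)) I).trans ?_
    rw [Pi.smul_apply, maximalMinor_eq_zero_of_not_bruhatLE hv hI, smul_zero]
  refine ⟨Pi.single ⟨W, hW⟩ P.det, hammingNorm_single_le _ _, ?_⟩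
  rw [pluckerCombination, Fintype.linearCombination_apply_single, ← maximalMinor_mul, ← hP]

/-- A point of the Schubert union has a basis subordinate to some element of `S`. -/
theorem exists_subordinate_basis {F : Type*} [Field F] {ℓ m : ℕ}
    {M : Grassmannian F ℓ m → Matrix (Fin ℓ) (Fin m) F} (hM : IsRepresentativeChoice M)
    {S : Set (IndexTuple ℓ m)} (hS : IsDownwardClosed S) {W : Grassmannian F ℓ m}
    (hW : W ∈ schubertUnion M S) :
    ∃ α ∈ S, ∃ (v : Fin ℓ → Fin m → F) (s : F), s ≠ 0 ∧ (∀ i j, α i < j → v i j = 0) ∧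
      maximalMinor v = s • maximalMinor (M W) := by
  classical
  obtain ⟨f₀, hf₀⟩ := exists_det_submatrix_ne_zero (hM.linearIndependent_row W)
  -- The pivots maximise the index sum: replacing a pivot by a later column raises the sum, so that
  -- minor vanishes, and by Cramer's rule so does the corresponding entry of the normal form.
  obtain ⟨f, hf, hmax⟩ := Finset.exists_max_image
    ({f | ((M W).submatrix id f).det ≠ 0} : Finset (Fin ℓ → Fin m)) (fun f => ∑ i, (f i : ℕ))
    ⟨f₀, by simpa using hf₀⟩
  simp only [Finset.mem_filter, Finset.mem_univ, true_and] at hf hmax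
  obtain ⟨I, σ, rfl⟩ := exists_indexTuple_comp_perm (injective_of_det_submatrix_ne_zero hf)
  have hI : ((M W).submatrix id I).det ≠ 0 := by
    rw [det_submatrix_comp_perm] at hf
    exact right_ne_zero_of_mul hf
  have hIS : I ∈ S := by
    obtain ⟨α, hα, hWα⟩ := Set.mem_iUnion₂.mp hW
    refine hS I α ?_ hα
    by_contra hle
    exact hI (hWα I hle)
  refine ⟨I, hIS, ((M W).submatrix id I)⁻¹ * M W, (((M W).submatrix id I)⁻¹).det, ?_, ?_,
    maximalMinor_mul _ _⟩
  · rw [Matrix.det_nonsing_inv, Ring.inverse_eq_inv']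
    exact inv_ne_zero hI
  · intro i j hij
    rw [inv_submatrix_mul_apply]
    refine mul_eq_zero_of_right _ ?_
    by_contra hne
    have hle := hmax _ hne
    have hperm : ∑ i, ((I ∘ σ) i : ℕ) = ∑ i, (I i : ℕ) := Equiv.sum_comp σ fun i => (I i : ℕ)
    rw [hperm] at hle
    refine hle.not_gt (Finset.sum_lt_sum (fun k _ => ?_) ⟨i, Finset.mem_univ i, by simpa⟩)
    by_cases hk : k = i
    · subst hk; simpa using hij.le
    · simp [hk]

/-! ### Coordinate subspaces -/

/-- The tuple of standard basis vectors indexed by `f`. -/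
def standardTuple (F : Type*) [Field F] {ℓ m : ℕ} (f : Fin ℓ → Fin m) : Fin ℓ → Fin m → F :=
  fun i => Pi.single (f i) 1

theorem standardTuple_eq_zero {F : Type*} [Field F] {ℓ m : ℕ} {f α : Fin ℓ → Fin m}
    (h : ∀ i, f i ≤ α i) (i : Fin ℓ) (j : Fin m) (hj : α i < j) :
    standardTuple F f i j = 0 :=
  Pi.single_eq_of_ne ((h i).trans_lt hj).ne' 1

/-- The matrix of these minors is triangular for the Bruhat order and symmetric by transposition,
hence diagonal by antisymmetry. -/
theorem maximalMinor_standardTuple (F : Type*) [Field F] {ℓ m : ℕ} (J : IndexTuple ℓ m) :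
    maximalMinor (standardTuple F J) = Pi.single J 1 := by
  have hle : ∀ I J : IndexTuple ℓ m, maximalMinor (standardTuple F J) I ≠ 0 → BruhatLE I J :=
    fun I J h => by
      by_contra hIJ
      exact h (maximalMinor_eq_zero_of_not_bruhatLE
        (standardTuple_eq_zero fun i => le_rfl) hIJ)
  have hsymm : ∀ I J : IndexTuple ℓ m,
      maximalMinor (standardTuple F J) I = maximalMinor (standardTuple F I) J := fun I J => by
    simp only [maximalMinor]
    rw [← Matrix.det_transpose]
    congr 1
    ext i j
    change standardTuple F J j (I i) = standardTuple F I i (J j)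
    simp [standardTuple, Pi.single_apply, eq_comm]
  ext I
  by_cases hIJ : I = J
  · subst hIJ
    rw [Pi.single_eq_same]
    change (Matrix.submatrix (standardTuple F I) id I).det = 1
    rw [← Matrix.det_one (n := Fin ℓ)]
    congr 1
    ext i j
    change standardTuple F I i (I j) = _
    simp [standardTuple, Pi.single_apply, Matrix.one_apply, eq_comm]
  · rw [Pi.single_eq_of_ne hIJ]
    by_contra h
    refine hIJ (DFunLike.ext _ _ fun i => le_antisymm (hle I J h i) (hle J I ?_ i))
    rwa [← hsymm]

theorem maximalMinor_standardTuple_comp_perm (F : Type*) [Field F] {ℓ m : ℕ}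
    (J : IndexTuple ℓ m) (σ : Equiv.Perm (Fin ℓ)) :
    maximalMinor (standardTuple F (J ∘ σ)) = Pi.single J (Equiv.Perm.sign σ : F) := by
  have h : maximalMinor (standardTuple F (J ∘ σ)) =
      (Equiv.Perm.sign σ : F) • maximalMinor (standardTuple F J) := by
    ext I
    exact Matrix.det_permute σ (Matrix.submatrix (standardTuple F J) id I)
  rw [h, maximalMinor_standardTuple, ← Pi.single_smul, smul_eq_mul, mul_one]

theorem maximalMinor_standardTuple_of_not_injective (F : Type*) [Field F] {ℓ m : ℕ}
    {f : Fin ℓ → Fin m} (hf : ¬ Function.Injective f) :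
    maximalMinor (standardTuple F f) = 0 := by
  simp only [Function.Injective, not_forall] at hf
  obtain ⟨i, j, hij, hne⟩ := hf
  ext I
  refine Matrix.det_zero_of_row_eq hne ?_
  ext k
  change standardTuple F f i (I k) = standardTuple F f j (I k)
  rw [standardTuple, standardTuple, hij]

theorem mem_span_single_iff {F : Type*} [Field F] {m : ℕ} {a : Fin m} {w : Fin m → F} :
    w ∈ Submodule.span F {u : Fin m → F | ∃ j ≤ a, u = Pi.single j 1} ↔
      ∀ j, a < j → w j = 0 := by
  constructor
  · intro hw j hj
    induction hw using Submodule.span_induction with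
    | mem u hu =>
      obtain ⟨k, hk, rfl⟩ := hu
      exact Pi.single_eq_of_ne (hk.trans_lt hj).ne' 1
    | zero => rfl
    | add x y _ _ hx hy => rw [Pi.add_apply, hx, hy, add_zero]
    | smul c x _ hx => rw [Pi.smul_apply, hx, smul_zero]
  · intro hw
    rw [pi_eq_sum_univ' w]
    refine Submodule.sum_mem _ fun j _ => ?_
    rcases le_or_gt j a with hj | hj
    · refine Submodule.smul_mem _ _ (Submodule.subset_span ⟨j, hj, ?_⟩)
      ext k
      simp [Pi.single_apply, eq_comm]
    · rw [hw j hj, zero_smul]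
      exact Submodule.zero_mem _

/-! ### Generation by relations of weight at most three -/

/-- The span of the dual codewords of weight at most three. -/
def lowWeightSpan {F : Type*} [Field F] [Finite F] [DecidableEq F] {ℓ m : ℕ}
    (M : Grassmannian F ℓ m → Matrix (Fin ℓ) (Fin m) F) (S : Set (IndexTuple ℓ m)) :
    Submodule F (schubertUnion M S → F) :=
  Submodule.span F {x | pluckerCombination M S x = 0 ∧ hammingNorm x ≤ 3}

/-- Modulo dual words of weight at most three, every word of weight at most one whose Plücker
vector comes from a tuple subordinate to `α ∈ S` is a combination of words supported at
coordinate subspaces. -/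
theorem mem_of_subordinate {F : Type*} [Field F] [Finite F] [DecidableEq F] {ℓ m : ℕ}
    {M : Grassmannian F ℓ m → Matrix (Fin ℓ) (Fin m) F} (hM : IsRepresentativeChoice M)
    {S : Set (IndexTuple ℓ m)} (hS : IsDownwardClosed S)
    {N : Submodule F (schubertUnion M S → F)} (hN : lowWeightSpan M S ≤ N)
    {y : S → schubertUnion M S → F} (hy1 : ∀ J, hammingNorm (y J) ≤ 1)
    (hy : ∀ J, pluckerCombination M S (y J) = Pi.single J.1 1) (hyN : ∀ J, y J ∈ N)
    {α : IndexTuple ℓ m} (hα : α ∈ S) {v : Fin ℓ → Fin m → F}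
    (hv : ∀ i j, α i < j → v i j = 0) {x : schubertUnion M S → F} (hx1 : hammingNorm x ≤ 1)
    (hx : pluckerCombination M S x = maximalMinor v) : x ∈ N := by
  have hlow : ∀ z, pluckerCombination M S z = 0 → hammingNorm z ≤ 3 → z ∈ N :=
    fun z hz hz3 => hN (Submodule.subset_span ⟨hz, hz3⟩)
  have hsmul_mem : ∀ (c : F) (z w : schubertUnion M S → F), hammingNorm z ≤ 1 →
      hammingNorm w ≤ 1 → w ∈ N →
      pluckerCombination M S z = c • pluckerCombination M S w → z ∈ N :=
    fun c z w hz hw hwN h => by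
      rw [← sub_add_cancel z (c • w)]
      refine N.add_mem (hlow _ ?_ ?_) (N.smul_mem c hwN)
      · rw [map_sub, map_smul, h, sub_self]
      · have h1 := hammingNorm_sub_le z (c • w)
        have h2 : hammingNorm (c • w) ≤ hammingNorm w := hammingNorm_smul_le_hammingNorm
        omega
  have hgood : ∀ (w : Fin ℓ → Fin m → F) (i : Fin ℓ) (a : Fin m → F),
      (∀ j, w j ∈ Submodule.span F {u : Fin m → F | ∃ k ≤ α j, u = Pi.single k 1}) →
      a ∈ Submodule.span F {u : Fin m → F | ∃ k ≤ α i, u = Pi.single k 1} →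
      ∃ z : schubertUnion M S → F, hammingNorm z ≤ 1 ∧
        pluckerCombination M S z = maximalMinor (Function.update w i a) := fun w i a hw ha => by
    refine exists_hammingNorm_le_one hM hα fun j k hjk => ?_
    by_cases hji : j = i
    · subst hji
      rw [Function.update_self]
      exact mem_span_single_iff.mp ha k hjk
    · rw [Function.update_of_ne hji]
      exact mem_span_single_iff.mp (hw j) k hjk
  refine forall_mem_span_of_slotwise (F := F)
    (fun i => {u : Fin m → F | ∃ j ≤ α i, u = Pi.single j 1})
    -- Quantifying over all such `x` makes the predicate independent of the chosen representing
    -- word.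
    (fun v => ∀ x, hammingNorm x ≤ 1 → pluckerCombination M S x = maximalMinor v → x ∈ N)
    ?_ ?_ ?_ ?_ v (fun i => mem_span_single_iff.mpr (hv i)) x hx1 hx
  · intro w i z hz1 hz
    refine hlow z ?_ (by omega)
    rw [hz, ← zero_smul F (0 : Fin m → F), maximalMinor_update_smul, zero_smul]
  · intro w i a b hw ha hb hQa hQb z hz1 hz
    obtain ⟨za, hza1, hza⟩ := hgood w i a hw ha
    obtain ⟨zb, hzb1, hzb⟩ := hgood w i b hw hb
    -- `z - za - zb` is a relation supported on at most three points.
    rw [← sub_add_cancel z za, ← sub_add_cancel (z - za) zb]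
    refine N.add_mem (N.add_mem (hlow _ ?_ ?_) (hQb zb hzb1 hzb)) (hQa za hza1 hza)
    · rw [map_sub, map_sub, hz, hza, hzb, maximalMinor_update_add]
      abel
    · have h1 := hammingNorm_sub_le (z - za) zb
      have h2 := hammingNorm_sub_le z za
      omega
  · intro w i c a hw ha hQa z hz1 hz
    obtain ⟨za, hza1, hza⟩ := hgood w i a hw ha
    refine hsmul_mem c z za hz1 hza1 (hQa za hza1 hza) ?_
    rw [hz, hza, maximalMinor_update_smul]
  · intro w hw z hz1 hz
    choose f hf hwf using hw
    obtain rfl : w = standardTuple F f := funext hwf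
    by_cases hinj : Function.Injective f
    · obtain ⟨J, σ, rfl⟩ := exists_indexTuple_comp_perm hinj
      rw [maximalMinor_standardTuple_comp_perm] at hz
      -- The minor on `J` is a sign, hence nonzero, which subordination to `α` permits only if `J ≤
      -- α`.
      have hJ : BruhatLE J α := by
        by_contra hle
        have h0 := maximalMinor_eq_zero_of_not_bruhatLE
          (standardTuple_eq_zero (F := F) hf) hle
        rw [maximalMinor_standardTuple_comp_perm, Pi.single_eq_same] at h0
        rcases Int.units_eq_one_or (Equiv.Perm.sign σ) with h | h <;> simp [h] at h0
      refine hsmul_mem (Equiv.Perm.sign σ : F) z (y ⟨J, hS J α hJ hα⟩) hz1 (hy1 _) (hyN _) ?_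
      rw [hz, hy, ← Pi.single_smul, smul_eq_mul, mul_one]
    · rw [maximalMinor_standardTuple_of_not_injective F hinj] at hz
      exact hlow z hz (by omega)

/-- The dual of a Schubert union code is spanned by its words of weight at most three. -/
theorem ker_pluckerCombination_le {F : Type*} [Field F] [Finite F] [DecidableEq F] {ℓ m : ℕ}
    {M : Grassmannian F ℓ m → Matrix (Fin ℓ) (Fin m) F} (hM : IsRepresentativeChoice M)
    {S : Set (IndexTuple ℓ m)} (hS : IsDownwardClosed S) :
    LinearMap.ker (pluckerCombination M S) ≤ lowWeightSpan M S := by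
  classical
  have := Fintype.ofFinite S
  choose y hy1 hy using fun J : S => exists_hammingNorm_le_one hM J.2
    (standardTuple_eq_zero (F := F) (f := J.1) fun i => le_rfl)
  simp only [maximalMinor_standardTuple] at hy
  have htop : lowWeightSpan M S ⊔ Submodule.span F (Set.range y) = ⊤ := by
    rw [eq_top_iff]
    intro x _
    rw [pi_eq_sum_univ' x]
    refine Submodule.sum_mem _ fun W _ => Submodule.smul_mem _ _ ?_
    obtain ⟨α, hα, v, s, hs, hv, hvW⟩ := exists_subordinate_basis hM hS W.2
    have hmem : (Pi.single W s : schubertUnion M S → F) ∈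
        lowWeightSpan M S ⊔ Submodule.span F (Set.range y) :=
      mem_of_subordinate hM hS le_sup_left hy1 hy
        (fun J => Submodule.mem_sup_right (Submodule.subset_span (Set.mem_range_self J))) hα hv
        (hammingNorm_single_le W s)
        (by rw [pluckerCombination, Fintype.linearCombination_apply_single, hvW])
    convert Submodule.smul_mem _ s⁻¹ hmem using 1
    ext V
    simp [Pi.single_apply, hs, eq_comm]
  intro x hx
  rw [LinearMap.mem_ker] at hx
  obtain ⟨k, hk, d, hd, rfl⟩ := Submodule.mem_sup.mp (htop.ge (Submodule.mem_top (x := x)))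
  have hk0 : pluckerCombination M S k = 0 := by
    have : lowWeightSpan M S ≤ LinearMap.ker (pluckerCombination M S) :=
      Submodule.span_le.mpr fun z hz => hz.1
    exact this hk
  obtain ⟨c, rfl⟩ := (Submodule.mem_span_range_iff_exists_fun F).mp hd
  rw [map_add, hk0, zero_add, map_sum] at hx
  -- Coordinate `J` of the Plücker combination is exactly `c J`.
  have hc : ∀ J, c J = 0 := fun J => by
    have h := congrFun hx J.1
    simpa [hy, Finset.sum_apply, Pi.single_apply, Subtype.coe_inj] using h
  simpa [hc] using hk

theorem mainTheorem4 {F : Type*} [Field F] [Finite F] [DecidableEq F] (ℓ m : ℕ)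
    (hℓ : 1 ≤ ℓ) (hℓm : ℓ ≤ m)
    (M : Grassmannian F ℓ m → Matrix (Fin ℓ) (Fin m) F) (hM : IsRepresentativeChoice M)
    (S : Set (IndexTuple ℓ m)) (hS : IsDownwardClosed S) :
    Submodule.span F (minimumWeightCodewords (dualCode (schubertUnionCode M S))) =
      dualCode (schubertUnionCode M S) := by
  refine le_antisymm (Submodule.span_le.mpr fun x hx => hx.1) fun x hx => ?_
  have hlow := ker_pluckerCombination_le hM hS
    (LinearMap.mem_ker.mpr (mem_dualCode_schubertUnionCode.mp hx))
  refine Submodule.span_le.mpr ?_ hlow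
  rintro z ⟨hz, hz3⟩
  by_cases h0 : z = 0
  · rw [h0]
    exact Submodule.zero_mem _
  · exact Submodule.subset_span ⟨mem_dualCode_schubertUnionCode.mpr hz, h0, fun y hy hy0 =>
      hz3.trans (three_le_hammingNorm hM (mem_dualCode_schubertUnionCode.mp hy) hy0)⟩
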